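/- Let $G$ be a finite group and let $N$ be a proper, nontrivial, normal subgroup of $G$ such that $(G,N)$ is an equal order pair, that is, for every $x\in G\setminus N$ all the elements of the coset $xN$ have the same order as $x$. Assume that $G$ is solvable and that $N$ is nilpotent. Then the Fitting height of $G$ is at most $4$. Here the Fitting height of $G$ is the least integer $n\ge 0$ with $F_n(G)=G$, where $F_0(G)=1$ and, for $i\geq 0$, $F_{i+1}(G)$ is the normal subgroup of $G$ containing $F_i(G)$ such that $F_{i+1}(G)/F_i(G)$ is the Fitting subgroup (the largest nilpotent normal subgroup) of $G/F_i(G)$. -/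

import Mathlib

/-- `(G, N)` is an equal order pair: `N` is a proper, nontrivial, normal subgroup of `G` and,
for every `x ∉ N`, all elements of the coset `xN` have the same order as `x`. -/
structure IsEqualOrderPair (G : Type*) [Group G] (N : Subgroup G) : Prop where
  normal : N.Normal
  ne_bot : N ≠ ⊥
  ne_top : N ≠ ⊤
  orderOf_mul_eq : ∀ x : G, x ∉ N → ∀ n ∈ N, orderOf (x * n) = orderOf x

/-- The Fitting subgroup: the subgroup generated by all nilpotent normal subgroups. -/
def fittingSubgroup (G : Type*) [Group G] : Subgroup G :=
  sSup {H : Subgroup G | H.Normal ∧ Group.IsNilpotent H}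

instance fittingSubgroup_normal (G : Type*) [Group G] : (fittingSubgroup G).Normal := by
  refine ⟨fun n hn g => ?_⟩
  have h : fittingSubgroup G ≤ (fittingSubgroup G).comap (MulAut.conj g).toMonoidHom :=
    sSup_le fun H hH x hx => (le_sSup hH : H ≤ fittingSubgroup G) (hH.1.conj_mem x hx g)
  exact h hn

/-- The upper Fitting series together with the normality of its terms:
`F 0 = 1`, and `F (n + 1) / F n` is the Fitting subgroup of `G / F n`. -/
def upperFittingSeriesAux (G : Type*) [Group G] : ℕ → {H : Subgroup G // H.Normal}
  | 0 => ⟨⊥, inferInstance⟩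
  | n + 1 =>
    let F := upperFittingSeriesAux G n
    haveI : F.1.Normal := F.2
    ⟨(fittingSubgroup (G ⧸ F.1)).comap (QuotientGroup.mk' F.1), inferInstance⟩

/-- The `n`-th term of the upper Fitting series of `G`. -/
def upperFittingSeries (G : Type*) [Group G] (n : ℕ) : Subgroup G :=
  (upperFittingSeriesAux G n).1

/-- The Fitting height of `G`: the least `n` such that the `n`-th term of the upper Fitting
series is `G`, and `⊤` if there is no such `n`. -/
noncomputable def fittingHeight (G : Type*) [Group G] : ℕ∞ :=
  ⨅ (n : ℕ) (_ : upperFittingSeries G n = ⊤), (n : ℕ∞)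

/-! Choose a nilpotent normal subgroup L ≥ N: L = N if |N| has two prime divisors, L = O_p(G) if N
is a p-group. If an r-element x outside L commuted with some v ∈ N of prime order p ≠ r, then xv
would have order p·o(x), against the equal order condition. So elements of order r in G/L act
without fixed points on the p-torsion of N ∩ C(L). When that torsion is nontrivial, G/L has no
noncyclic subgroup of order r², as for a Frobenius complement
(`IsEqualOrderPair.mem_zpowers_of_commute`). This covers every prime r except r = p when N is a
p-group, and then G/L has no nontrivial normal r-subgroup.

Let F be a nilpotent normal subgroup of G/L containing its centralizer. Abelian subgroups of its
Sylow subgroups R are cyclic. It follows that (G/L)'' centralizes R for odd r, and acts on R by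
inner automorphisms of R for r = 2
(`Subgroup.HasCyclicTorsion.exists_derivedSeries_two_mul_mem_centralizer`). Hence (G/L)'' ≤ F·C(F) =
F, and the height is at most 1 for L, 1 for F and 2 for the metabelian quotient by F. -/

open scoped commutatorElement

/-! ### Upper Fitting series and the height bound. -/

section FittingSeries

variable {G : Type*} [Group G]

instance upperFittingSeries_normal (n : ℕ) : (upperFittingSeries G n).Normal :=
  (upperFittingSeriesAux G n).2

theorem upperFittingSeries_succ (n : ℕ) : upperFittingSeries G (n + 1) =
    (fittingSubgroup (G ⧸ upperFittingSeries G n)).comap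
      (QuotientGroup.mk' (upperFittingSeries G n)) := rfl

theorem le_upperFittingSeries_succ {n : ℕ} {L K : Subgroup G} [L.Normal] [K.Normal]
    (hL : L ≤ upperFittingSeries G n)
    (hK : Group.IsNilpotent (K.map (QuotientGroup.mk' L))) :
    K ≤ upperFittingSeries G (n + 1) := by
  rw [upperFittingSeries_succ, ← Subgroup.map_le_iff_le_comap]
  refine le_sSup ⟨Subgroup.Normal.map ‹_› _ (QuotientGroup.mk'_surjective _), ?_⟩
  have h : K.map (QuotientGroup.mk' (upperFittingSeries G n)) =
      (K.map (QuotientGroup.mk' L)).map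
        (QuotientGroup.map L (upperFittingSeries G n) (MonoidHom.id G) hL) := by
    rw [Subgroup.map_map]
    rfl
  rw [h]
  exact Group.nilpotent_of_surjective _ (MonoidHom.subgroupMap_surjective
    (QuotientGroup.map L (upperFittingSeries G n) (MonoidHom.id G) hL) _)

theorem le_upperFittingSeries_succ_of_commutator_le {n : ℕ} {K : Subgroup G} [K.Normal]
    (hK : ⁅K, K⁆ ≤ upperFittingSeries G n) : K ≤ upperFittingSeries G (n + 1) := by
  refine le_upperFittingSeries_succ le_rfl ?_
  have h : ⁅K.map (QuotientGroup.mk' (upperFittingSeries G n)),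
      K.map (QuotientGroup.mk' (upperFittingSeries G n))⁆ = ⊥ := by
    rw [← Subgroup.map_commutator, Subgroup.map_eq_bot_iff, QuotientGroup.ker_mk']
    exact hK
  exact Subgroup.isNilpotent_of_lowerCentralSeries_eq_bot (n := 1) (by simpa using h)

theorem fittingHeight_le {n : ℕ} (h : upperFittingSeries G n = ⊤) : fittingHeight G ≤ n :=
  iInf₂_le n h

/-- A group with a normal nilpotent subgroup modulo which the second derived subgroup lies in a
normal nilpotent subgroup has Fitting height at most four. -/
theorem fittingHeight_le_four {L : Subgroup G} [L.Normal] (hL : Group.IsNilpotent L)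
    {F : Subgroup (G ⧸ L)} [F.Normal] (hF : Group.IsNilpotent F)
    (h : derivedSeries (G ⧸ L) 2 ≤ F) : fittingHeight G ≤ 4 := by
  have h1 : L ≤ upperFittingSeries G 1 := by
    refine le_upperFittingSeries_succ (L := ⊥) bot_le ?_
    exact Group.nilpotent_of_surjective _ (MonoidHom.subgroupMap_surjective
      (QuotientGroup.mk' (⊥ : Subgroup G)) L)
  have h2 : F.comap (QuotientGroup.mk' L) ≤ upperFittingSeries G 2 := by
    refine le_upperFittingSeries_succ h1 ?_
    rwa [Subgroup.map_comap_eq_self_of_surjective (QuotientGroup.mk'_surjective L)]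
  have h2' : derivedSeries G 2 ≤ upperFittingSeries G 2 := by
    refine le_trans ?_ h2
    rw [← Subgroup.map_le_iff_le_comap]
    exact (map_derivedSeries_le_derivedSeries _ 2).trans h
  have h3 : derivedSeries G 1 ≤ upperFittingSeries G 3 := by
    have := derivedSeries_normal G 1
    exact le_upperFittingSeries_succ_of_commutator_le h2'
  have h4 : (⊤ : Subgroup G) ≤ upperFittingSeries G 4 :=
    le_upperFittingSeries_succ_of_commutator_le h3
  exact_mod_cast fittingHeight_le (top_le_iff.1 h4)

end FittingSeries

/-! ### Self-centralizing nilpotent normal subgroups. -/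

section SelfCentralizing

variable {G : Type*} [Group G]

/-- Since F and B commute elementwise, FB is a homomorphic image of F × B. -/
theorem Subgroup.isNilpotent_sup_of_le_centralizer {F B : Subgroup G}
    (hF : Group.IsNilpotent F) (hB : Group.IsNilpotent B)
    (h : B ≤ Subgroup.centralizer (F : Set G)) : Group.IsNilpotent (F ⊔ B : Subgroup G) := by
  have comm : ∀ (m : F) (n : B), Commute (F.subtype m) (B.subtype n) := fun m n =>
    Subgroup.mem_centralizer_iff.1 (h n.2) m m.2
  have hr := MonoidHom.noncommCoprod_range F.subtype B.subtype comm
  rw [Subgroup.range_subtype, Subgroup.range_subtype] at hr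
  rw [← hr]
  exact Group.nilpotent_of_surjective _
    (MonoidHom.rangeRestrict_surjective (MonoidHom.noncommCoprod F.subtype B.subtype comm))

/-- A nontrivial normal subgroup of a solvable group contains a nontrivial abelian normal
subgroup of the group. -/
theorem Subgroup.exists_normal_commutator_eq_bot [Group.IsSolvable G] {H : Subgroup G} [H.Normal]
    (hH : H ≠ ⊥) : ∃ A : Subgroup G, A.Normal ∧ A ≤ H ∧ A ≠ ⊥ ∧ ⁅A, A⁆ = ⊥ := by
  obtain ⟨n, hn⟩ := Group.IsSolvable.solvable (G := H)
  -- The last nontrivial derived subgroup of `H` is abelian and characteristic in `H`, hence normal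
  -- in `G`.
  have key : ∀ n, derivedSeries H n = ⊥ →
      ∃ A : Subgroup H, A.Characteristic ∧ A ≠ ⊥ ∧ ⁅A, A⁆ = ⊥ := by
    intro n
    induction n with
    | zero =>
      intro h
      rw [derivedSeries_zero] at h
      refine absurd ((Subgroup.eq_bot_iff_forall H).2 fun x hx => ?_) hH
      have : (⟨x, hx⟩ : H) ∈ (⊥ : Subgroup H) := h ▸ Subgroup.mem_top _
      exact congrArg Subtype.val (Subgroup.mem_bot.1 this)
    | succ n ih =>
      intro h
      by_cases h0 : derivedSeries H n = ⊥
      · exact ih h0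
      · exact ⟨derivedSeries H n, inferInstance, h0, h⟩
  obtain ⟨A, hA, hA0, hAc⟩ := key n hn
  refine ⟨A.map H.subtype, inferInstance, Subgroup.map_subtype_le A, ?_, ?_⟩
  · rwa [Ne, Subgroup.map_eq_bot_iff_of_injective _ H.subtype_injective]
  · rw [← Subgroup.map_commutator, hAc, Subgroup.map_bot]

/-- A finite solvable group has a normal nilpotent subgroup containing its centralizer. -/
theorem exists_normal_isNilpotent_centralizer_le [Finite G] [Group.IsSolvable G] :
    ∃ F : Subgroup G, F.Normal ∧ Group.IsNilpotent F ∧ Subgroup.centralizer (F : Set G) ≤ F := by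
  obtain ⟨F, ⟨hFn, hF⟩, hmax⟩ := Set.Finite.exists_maximal
    (Set.toFinite {F : Subgroup G | F.Normal ∧ Group.IsNilpotent F})
    ⟨⊥, inferInstance, inferInstance⟩
  refine ⟨F, hFn, hF, ?_⟩
  by_contra hC
  set C := Subgroup.centralizer (F : Set G) with hCdef
  have hne : C.map (QuotientGroup.mk' F) ≠ ⊥ := by
    rwa [Ne, Subgroup.map_eq_bot_iff, QuotientGroup.ker_mk']
  have : (C.map (QuotientGroup.mk' F)).Normal :=
    Subgroup.Normal.map inferInstance _ (QuotientGroup.mk'_surjective _)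
  obtain ⟨A, hAn, hAC, hA0, hAA⟩ := Subgroup.exists_normal_commutator_eq_bot hne
  -- [B, B] ≤ F is centralized by `B`, so `B` has class at most two. Then FB is nilpotent and
  -- maximality of `F` gives B ≤ F, although `A` is nontrivial.
  let B : Subgroup G := A.comap (QuotientGroup.mk' F) ⊓ C
  have hBC : B ≤ C := inf_le_right
  have hBB : ⁅B, B⁆ ≤ F := by
    rw [← QuotientGroup.ker_mk' F, ← Subgroup.map_eq_bot_iff, Subgroup.map_commutator, eq_bot_iff,
      ← hAA]
    have : B.map (QuotientGroup.mk' F) ≤ A := Subgroup.map_le_iff_le_comap.2 inf_le_left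
    exact Subgroup.commutator_mono this this
  have hBBB : ⁅⁅B, B⁆, B⁆ = ⊥ := by
    rw [Subgroup.commutator_eq_bot_iff_le_centralizer]
    exact hBB.trans (Subgroup.le_centralizer_iff.1 hBC)
  have hBnil : Group.IsNilpotent B :=
    Subgroup.isNilpotent_of_lowerCentralSeries_eq_bot (n := 2) hBBB
  have hBF : B ≤ F := le_sup_right.trans (hmax (y := F ⊔ B)
    ⟨inferInstance, Subgroup.isNilpotent_sup_of_le_centralizer hF hBnil hBC⟩ le_sup_left)
  apply hA0
  rw [eq_bot_iff]
  intro a ha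
  obtain ⟨c, hc, rfl⟩ := hAC ha
  have : c ∈ F := hBF ⟨ha, hc⟩
  simpa using this

end SelfCentralizing

/-! ### Fixed-point-free action on the p-torsion. -/

section Frobenius

/-- Two commuting elements of order dividing `r` in a ring cannot act freely unless `r = 0`. -/
theorem natCast_eq_zero_of_fixedPointFree {S : Type*} [Ring S] {r : ℕ} {X Y : S}
    (hr : 0 < r) (hXY : Commute X Y) (hX : X ^ r = 1) (hY : Y ^ r = 1)
    (hYX : ∀ i, ∀ s : S, Y * X ^ i * s = s → s = 0)
    (hXj : ∀ j, 0 < j → j < r → ∀ s : S, X ^ j * s = s → s = 0) : (r : S) = 0 := by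
  have norm : ∀ T : S, T ^ r = 1 → (∀ s : S, T * s = s → s = 0) →
      ∑ i ∈ Finset.range r, T ^ i = 0 := by
    intro T hT h
    apply h
    have := mul_geom_sum T r
    rwa [hT, sub_self, sub_mul, one_mul, sub_eq_zero] at this
  -- Each inner sum is fixed by Y·X^i, so it vanishes. After swapping the sums, the terms with j ≠ 0
  -- vanish likewise through X^j, and j = 0 contributes `r`.
  have h1 : ∑ i ∈ Finset.range r, ∑ j ∈ Finset.range r, (Y * X ^ i) ^ j = 0 := by
    refine Finset.sum_eq_zero fun i _ => norm _ ?_ (hYX i)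
    rw [(hXY.symm.pow_right i).mul_pow, hY, ← pow_mul, mul_comm, pow_mul, hX, one_pow, one_mul]
  rw [Finset.sum_comm, Finset.sum_eq_single_of_mem 0 (Finset.mem_range.2 hr)] at h1
  · simpa using h1
  · intro j hj hj0
    have h2 : ∀ i, (Y * X ^ i) ^ j = Y ^ j * (X ^ j) ^ i := fun i => by
      rw [(hXY.symm.pow_right i).mul_pow, ← pow_mul, ← pow_mul, mul_comm]
    simp_rw [h2, ← Finset.mul_sum]
    rw [norm, mul_zero]
    · rw [← pow_mul, mul_comm, pow_mul, hX, one_pow]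
    · exact hXj j (Nat.pos_of_ne_zero hj0) (Finset.mem_range.1 hj)

variable {G : Type*} [Group G]

/-- The conjugation action on a commutative normal subgroup, by additive endomorphisms. -/
def conjAddEnd (V : Subgroup G) [V.Normal] : G →* AddMonoid.End (Additive V) where
  toFun g := MonoidHom.toAdditive (MulAut.conjNormal g : MulAut V).toMonoidHom
  map_one' := by rw [map_one]; rfl
  map_mul' a b := by rw [map_mul]; rfl

theorem conjAddEnd_eq_iff (V : Subgroup G) [V.Normal] (g : G) (v : Additive V) :
    conjAddEnd V g v = v ↔ g * (v.toMul : G) = v.toMul * g := by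
  rw [← mul_inv_eq_iff_eq_mul, ← MulAut.conjNormal_apply, ← Subtype.ext_iff]
  rfl

variable [Finite G] {N : Subgroup G}

theorem IsEqualOrderPair.eq_one_of_commute (hN : IsEqualOrderPair G N) {L : Subgroup G}
    [L.Normal] (hNL : N ≤ L) {p r : ℕ} (hp : p.Prime) (hr : r.Prime) (hpr : p ≠ r) {g v : G}
    (hg : g ∉ L) (hgr : g ^ r ∈ L) (hv : v ∈ N) (hvp : v ^ p = 1) (hgv : Commute g v) :
    v = 1 := by
  -- g^m is an `r`-element. It stays outside `L` because `g` has order `r` modulo `L` and `r` does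
  -- not divide `m`.
  obtain ⟨k, m, hm, hgm⟩ := Nat.exists_eq_pow_mul_and_not_dvd (orderOf_pos g).ne' r hr.ne_one
  have hx : g ^ m ∉ L := by
    intro h
    apply hg
    have h1 : ((g : G ⧸ L)) ^ m = 1 := by
      rw [← QuotientGroup.mk_pow]; exact (QuotientGroup.eq_one_iff _).2 h
    have h2 : ((g : G ⧸ L)) ^ r = 1 := by
      rw [← QuotientGroup.mk_pow]; exact (QuotientGroup.eq_one_iff _).2 hgr
    have h3 : orderOf (g : G ⧸ L) ∣ 1 := by
      rw [← ((Nat.Prime.coprime_iff_not_dvd hr).2 hm).gcd_eq_one]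
      exact Nat.dvd_gcd (orderOf_dvd_of_pow_eq_one h2) (orderOf_dvd_of_pow_eq_one h1)
    rw [← QuotientGroup.eq_one_iff]
    exact orderOf_eq_one_iff.1 (Nat.dvd_one.1 h3)
  have hxo : orderOf (g ^ m) ∣ r ^ k := by
    apply orderOf_dvd_of_pow_eq_one
    rw [← pow_mul, mul_comm, ← hgm, pow_orderOf_eq_one]
  have hcop : (orderOf (g ^ m)).Coprime (orderOf v) :=
    Nat.Coprime.of_dvd hxo (orderOf_dvd_of_pow_eq_one hvp)
      (Nat.Coprime.pow_left k ((Nat.coprime_primes hr hp).2 hpr.symm))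
  have h1 := hN.orderOf_mul_eq (g ^ m) (fun h => hx (hNL h)) v hv
  rw [(hgv.pow_left m).orderOf_mul_eq_mul_orderOf_of_coprime hcop] at h1
  exact orderOf_eq_one_iff.1 (Nat.eq_of_mul_eq_mul_left (orderOf_pos (g ^ m)) (by omega))

/-- If `L ≥ N` centralizes an element of order `p` in `N`, then for primes `r ≠ p` the quotient
`G ⧸ L` has no noncyclic subgroup of order `r ^ 2`. -/
theorem IsEqualOrderPair.mem_zpowers_of_commute (hN : IsEqualOrderPair G N) {L : Subgroup G}
    [L.Normal] (hNL : N ≤ L) {p r : ℕ} (hp : p.Prime) (hr : r.Prime) (hpr : p ≠ r)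
    {v : G} (hv : v ∈ N) (hvL : v ∈ Subgroup.centralizer (L : Set G)) (hvp : v ^ p = 1)
    (hv1 : v ≠ 1) {x y : G ⧸ L} (hxy : Commute x y) (hx : x ^ r = 1) (hy : y ^ r = 1)
    (hx1 : x ≠ 1) : y ∈ Subgroup.zpowers x := by
  by_contra hyx
  have := hN.normal
  have hcommV : ∀ a ∈ N ⊓ Subgroup.centralizer (L : Set G),
      ∀ b ∈ N ⊓ Subgroup.centralizer (L : Set G), a * b = b * a := fun a ha b hb =>
    Subgroup.mem_centralizer_iff.1 hb.2 a (hNL ha.1)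
  -- The p-torsion of N ∩ C(L), which is abelian because N ≤ L. As `L` centralizes it, G/L acts on
  -- it.
  let V : Subgroup G :=
    { carrier := {a | a ∈ N ⊓ Subgroup.centralizer (L : Set G) ∧ a ^ p = 1}
      one_mem' := ⟨one_mem _, one_pow _⟩
      mul_mem' := fun {a b} ha hb => ⟨mul_mem ha.1 hb.1, by
        rw [Commute.mul_pow (hcommV a ha.1 b hb.1), ha.2, hb.2, one_mul]⟩
      inv_mem' := fun {a} ha => ⟨inv_mem ha.1, by rw [inv_pow, ha.2, inv_one]⟩ }
  have hVn : V.Normal := ⟨fun a ha g => ⟨Subgroup.Normal.conj_mem inferInstance a ha.1 g, by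
    rw [conj_pow, ha.2, mul_one, mul_inv_cancel]⟩⟩
  let _ : CommGroup V := { (inferInstance : Group V) with
    mul_comm := fun a b => Subtype.ext (hcommV a a.2.1 b b.2.1) }
  have hker : ∀ g ∈ L, conjAddEnd V g = 1 := by
    intro g hg
    ext1 u
    rw [AddMonoid.End.coe_one, id, conjAddEnd_eq_iff]
    exact Subgroup.mem_centralizer_iff.1 u.toMul.2.1.2 g hg
  let φ : G ⧸ L →* AddMonoid.End (Additive V) := QuotientGroup.lift L (conjAddEnd V) hker
  have hfree : ∀ z : G ⧸ L, z ^ r = 1 → z ≠ 1 → ∀ s : AddMonoid.End (Additive V),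
      φ z * s = s → s = 0 := by
    intro z
    induction z using QuotientGroup.induction_on with | H g => ?_
    intro hz hz1 s hs
    ext1 u
    have h1 : conjAddEnd V g (s u) = s u := DFunLike.congr_fun hs u
    rw [conjAddEnd_eq_iff] at h1
    have h2 := hN.eq_one_of_commute hNL hp hr hpr (fun h => hz1 ((QuotientGroup.eq_one_iff g).2 h))
      ((QuotientGroup.eq_one_iff _).1 hz) (s u).toMul.2.1.1 (s u).toMul.2.2 h1
    exact Subtype.ext h2
  have hxo : orderOf x = r := by
    have := Fact.mk hr
    exact orderOf_eq_prime hx hx1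
  have h0 : (r : AddMonoid.End (Additive V)) = 0 := by
    refine natCast_eq_zero_of_fixedPointFree (X := φ x) (Y := φ y) hr.pos (hxy.map φ)
      (by rw [← map_pow, hx, map_one]) (by rw [← map_pow, hy, map_one]) (fun i => ?_)
      (fun j hj hjr => ?_)
    · rw [← map_pow, ← map_mul]
      refine hfree _ ?_ fun h => hyx ?_
      · rw [(hxy.symm.pow_right i).mul_pow, hy, ← pow_mul, mul_comm, pow_mul, hx, one_pow,
          one_mul]
      · rw [eq_inv_of_mul_eq_one_left h]
        exact inv_mem (pow_mem (Subgroup.mem_zpowers x) i)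
    · rw [← map_pow]
      refine hfree _ ?_ (pow_ne_one_of_lt_orderOf hj.ne' (hxo ▸ hjr))
      rw [← pow_mul, mul_comm, pow_mul, hx, one_pow]
  let u : V := ⟨v, ⟨hv, hvL⟩, hvp⟩
  have h1 : r • (Additive.ofMul u) = 0 := by
    have := DFunLike.congr_fun h0 (Additive.ofMul u)
    simpa using this
  have hvr : v ^ r = 1 := by
    have := congrArg (fun a : Additive V => (a.toMul : G)) h1
    simpa [u] using this
  have : orderOf v ∣ 1 := by
    rw [← ((Nat.coprime_primes hp hr).2 hpr).gcd_eq_one]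
    exact Nat.dvd_gcd (orderOf_dvd_of_pow_eq_one hvp) (orderOf_dvd_of_pow_eq_one hvr)
  exact hv1 (orderOf_eq_one_iff.1 (Nat.dvd_one.1 this))

end Frobenius

/-! ### r-groups whose commuting r-torsion is cyclic. -/

section CyclicTorsion

variable {G : Type*} [Group G]

/-- Any two commuting elements of `R` whose `r`-th power is trivial generate a cyclic group;
that is, for prime `r`, no subgroup of `R` is noncyclic of order `r ^ 2`. -/
def Subgroup.HasCyclicTorsion (R : Subgroup G) (r : ℕ) : Prop :=
  ∀ x ∈ R, ∀ y ∈ R, Commute x y → x ^ r = 1 → y ^ r = 1 → x ≠ 1 → y ∈ Subgroup.zpowers x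

variable {r : ℕ} {R : Subgroup G}

theorem Subgroup.HasCyclicTorsion.mem_zpowers_of_orderOf (hU : R.HasCyclicTorsion r)
    (hr : r.Prime) {a : G} (ha : a ∈ R) {m : ℕ} (hm : orderOf a = r ^ m) (n : ℕ) :
    ∀ b ∈ R, Commute a b → orderOf b = r ^ n → n ≤ m → b ∈ Subgroup.zpowers a := by
  induction n with
  | zero =>
    intro b _ _ hb _
    rw [pow_zero, orderOf_eq_one_iff] at hb
    exact hb ▸ one_mem _
  | succ n ih =>
    intro b hbR hab hb hnm
    have hbr : orderOf (b ^ r) = r ^ n := by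
      rw [orderOf_pow_of_dvd hr.ne_zero (hb ▸ dvd_pow_self r n.succ_ne_zero), hb, pow_succ,
        Nat.mul_div_cancel _ hr.pos]
    have hfin : IsOfFinOrder a := by
      rw [← orderOf_pos_iff, hm]; exact pow_pos hr.pos m
    obtain ⟨k, hk⟩ := hfin.mem_powers_iff_mem_zpowers.2
      (ih (b ^ r) (pow_mem hbR r) (hab.pow_right r) hbr (by omega))
    replace hk : a ^ k = b ^ r := hk
    -- If k = rt, then b·a^(-t) has `r`-th power 1 and lies in the subgroup of order `r` of ⟨a⟩.
    -- Otherwise b^r = a^k would have order r^m, which is too large.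
    by_cases hrk : r ∣ k
    · obtain ⟨t, rfl⟩ := hrk
      have hm1 : m - 1 + 1 = m := by omega
      have hc : b * (a ^ t)⁻¹ ∈ Subgroup.zpowers (a ^ r ^ (m - 1)) := by
        refine hU _ (pow_mem ha _) _ (mul_mem hbR (inv_mem (pow_mem ha t)))
          ((hab.mul_right ((Commute.refl a).pow_right t).inv_right).pow_left _) ?_ ?_ ?_
        · rw [← pow_mul, ← pow_succ, hm1, ← hm, pow_orderOf_eq_one]
        · rw [((hab.symm.pow_right t).inv_right).mul_pow, inv_pow, ← pow_mul, mul_comm t, hk,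
            mul_inv_cancel]
        · refine pow_ne_one_of_lt_orderOf (pow_pos hr.pos _).ne' ?_
          rw [hm]
          exact Nat.pow_lt_pow_right hr.one_lt (by omega)
      have h2 := mul_mem ((Subgroup.zpowers_le.2 (pow_mem (Subgroup.mem_zpowers a) _)) hc)
        (pow_mem (Subgroup.mem_zpowers a) t)
      rwa [inv_mul_cancel_right] at h2
    · have h1 : orderOf (a ^ k) = orderOf a :=
        Nat.Coprime.orderOf_pow (hm ▸ Nat.Coprime.pow_left m ((Nat.Prime.coprime_iff_not_dvd hr).2 hrk))
      rw [hk, hbr, hm] at h1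
      have := Nat.pow_right_injective hr.two_le h1
      omega

theorem IsPGroup.exists_orderOf_eq [hr : Fact r.Prime] (hR : IsPGroup r R) {a : G} (ha : a ∈ R) :
    ∃ k, orderOf a = r ^ k := by
  obtain ⟨k, hk⟩ := IsPGroup.iff_orderOf.1 hR ⟨a, ha⟩
  exact ⟨k, by rwa [Subgroup.orderOf_mk] at hk⟩

variable [hr : Fact r.Prime]

theorem Subgroup.HasCyclicTorsion.mem_zpowers_or (hU : R.HasCyclicTorsion r) (hR : IsPGroup r R)
    {a b : G} (ha : a ∈ R) (hb : b ∈ R) (hab : Commute a b) :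
    b ∈ Subgroup.zpowers a ∨ a ∈ Subgroup.zpowers b := by
  obtain ⟨m, hm⟩ := hR.exists_orderOf_eq ha
  obtain ⟨n, hn⟩ := hR.exists_orderOf_eq hb
  rcases le_total n m with h | h
  · exact Or.inl (hU.mem_zpowers_of_orderOf hr.out ha hm n b hb hab hn h)
  · exact Or.inr (hU.mem_zpowers_of_orderOf hr.out hb hn m a ha hab.symm hm h)

theorem Subgroup.HasCyclicTorsion.isCyclic [Finite G] (hU : R.HasCyclicTorsion r)
    (hR : IsPGroup r R) {A : Subgroup G} (hAR : A ≤ R) (hA : A ≤ Subgroup.centralizer (A : Set G)) :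
    IsCyclic A := by
  obtain ⟨a, ha⟩ := Finite.exists_max fun a : A => orderOf (a : G)
  refine ⟨a, fun b => ?_⟩
  have key : (b : G) ∈ Subgroup.zpowers (a : G) := by
    rcases hU.mem_zpowers_or hR (hAR a.2) (hAR b.2)
      (Subgroup.mem_centralizer_iff.1 (hA b.2) a a.2) with h | h
    · exact h
    · rw [Subgroup.eq_of_le_of_card_ge (Subgroup.zpowers_le.2 h)
        (by rw [Nat.card_zpowers, Nat.card_zpowers]; exact ha b)]
      exact Subgroup.mem_zpowers _
  obtain ⟨k, hk⟩ := key
  exact ⟨k, Subtype.ext (by simpa using hk)⟩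

/-- The automorphism group of a cyclic group is abelian, so commutators act trivially on `A`. -/
theorem commutator_le_centralizer_of_isCyclic {A : Subgroup G} [A.Normal] (hA : IsCyclic A) :
    commutator G ≤ Subgroup.centralizer (A : Set G) := by
  rw [commutator_def, Subgroup.commutator_le]
  intro g _ h _
  have hc : (MulAut.conjNormal ⁅g, h⁆ : MulAut A) = 1 := by
    rw [map_commutatorElement, commutatorElement_eq_one_iff_mul_comm]
    apply (IsCyclic.mulAutMulEquiv A).injective
    rw [map_mul, map_mul, mul_comm]
  rw [Subgroup.mem_centralizer_iff]
  intro a ha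
  have h1 := congrArg (fun f : MulAut A => (f ⟨a, ha⟩ : G)) hc
  simp only [MulAut.conjNormal_apply, MulAut.one_apply] at h1
  exact (mul_inv_eq_iff_eq_mul.1 h1).symm

/-- [R, G'] lies in C_R(A) ≤ A, which G' centralizes. The three subgroups lemma then gives [G'', R]
= 1. -/
theorem derivedSeries_two_le_centralizer {A R : Subgroup G} [R.Normal]
    (hA : commutator G ≤ Subgroup.centralizer (A : Set G))
    (hAR : R ⊓ Subgroup.centralizer (A : Set G) ≤ A) :
    derivedSeries G 2 ≤ Subgroup.centralizer (R : Set G) := by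
  have h1 : ⁅R, commutator G⁆ ≤ A :=
    ((Subgroup.commutator_le_inf R (commutator G)).trans (inf_le_inf_left R hA)).trans hAR
  have h2 : ⁅⁅R, commutator G⁆, commutator G⁆ = ⊥ :=
    Subgroup.commutator_eq_bot_iff_le_centralizer.2 (h1.trans (Subgroup.le_centralizer_iff.1 hA))
  rw [← Subgroup.commutator_eq_bot_iff_le_centralizer]
  exact Subgroup.commutator_commutator_eq_bot_of_rotate
    (by rwa [Subgroup.commutator_comm _ R]) h2

/-- A normal `r`-subgroup `C` properly containing a normal subgroup `A` contains a normal subgroup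
`B` not contained in `A` such that `B / A` is central in `C / A` and has exponent `r`. -/
theorem IsPGroup.exists_normal_central_exponent [Finite G] {A C : Subgroup G} [A.Normal]
    [C.Normal] (hC : IsPGroup r C) (hAC : A ≤ C) (hne : ¬ C ≤ A) :
    ∃ B : Subgroup G, B.Normal ∧ A ≤ B ∧ B ≤ C ∧ ¬ B ≤ A ∧ (∀ b ∈ B, b ^ r ∈ A) ∧
      ∀ b ∈ B, ∀ c ∈ C, ⁅b, c⁆ ∈ A := by
  let D : Subgroup (G ⧸ A) := C.map (QuotientGroup.mk' A)
  have hDn : D.Normal := Subgroup.Normal.map ‹_› _ (QuotientGroup.mk'_surjective _)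
  have hcomm : ∀ a ∈ D ⊓ Subgroup.centralizer (D : Set (G ⧸ A)),
      ∀ b ∈ D ⊓ Subgroup.centralizer (D : Set (G ⧸ A)), Commute a b := fun a ha b hb =>
    Subgroup.mem_centralizer_iff.1 hb.2 a ha.1
  -- The r-torsion of the centre of C/A; the subgroup sought is its preimage.
  let E : Subgroup (G ⧸ A) :=
    { carrier := {a | a ∈ D ⊓ Subgroup.centralizer (D : Set (G ⧸ A)) ∧ a ^ r = 1}
      one_mem' := ⟨one_mem _, one_pow _⟩
      mul_mem' := fun {a b} ha hb => ⟨mul_mem ha.1 hb.1, by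
        rw [(hcomm a ha.1 b hb.1).mul_pow, ha.2, hb.2, one_mul]⟩
      inv_mem' := fun {a} ha => ⟨inv_mem ha.1, by rw [inv_pow, ha.2, inv_one]⟩ }
  have hEn : E.Normal := ⟨fun a ha g => ⟨Subgroup.Normal.conj_mem inferInstance a ha.1 g, by
    rw [conj_pow, ha.2, mul_one, mul_inv_cancel]⟩⟩
  refine ⟨E.comap (QuotientGroup.mk' A), inferInstance, ?_, ?_, ?_, ?_, ?_⟩
  · intro a ha
    rw [Subgroup.mem_comap, QuotientGroup.mk'_apply, (QuotientGroup.eq_one_iff a).2 ha]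
    exact one_mem E
  · intro b hb
    have h1 : b ∈ D.comap (QuotientGroup.mk' A) := hb.1.1
    rwa [Subgroup.comap_map_eq_self (by rwa [QuotientGroup.ker_mk'])] at h1
  · intro hBA
    have hD0 : D ≠ ⊥ := by
      rwa [Ne, Subgroup.map_eq_bot_iff, QuotientGroup.ker_mk']
    have : Nontrivial D := (Subgroup.nontrivial_iff_ne_bot D).2 hD0
    have hDp : IsPGroup r D := hC.map _
    have := hDp.center_nontrivial
    have hdvd : r ∣ Nat.card (Subgroup.center D) :=
      (hDp.to_subgroup (Subgroup.center D)).card_eq_or_dvd.resolve_left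
        Finite.one_lt_card.ne'
    obtain ⟨z, hz⟩ := exists_prime_orderOf_dvd_card' r hdvd
    have hz1 : ((z : D) : G ⧸ A) ∈ E := by
      refine ⟨⟨(z : D).2, Subgroup.mem_centralizer_iff.2 fun d hd => ?_⟩, ?_⟩
      · exact congrArg Subtype.val (Subgroup.mem_center_iff.1 z.2 ⟨d, hd⟩)
      · have := pow_orderOf_eq_one z
        rw [hz] at this
        simpa using congrArg (fun u : Subgroup.center D => ((u : D) : G ⧸ A)) this
    obtain ⟨g, hg⟩ := QuotientGroup.mk'_surjective A ((z : D) : G ⧸ A)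
    have hgA : g ∈ A := hBA (by rw [Subgroup.mem_comap, hg]; exact hz1)
    rw [QuotientGroup.mk'_apply, (QuotientGroup.eq_one_iff g).2 hgA] at hg
    have hz0 : z = 1 := Subtype.ext (Subtype.ext hg.symm)
    rw [hz0, orderOf_one] at hz
    exact hr.out.one_lt.ne hz
  · intro b hb
    rw [← QuotientGroup.eq_one_iff, QuotientGroup.mk_pow]
    exact hb.2
  · intro b hb c hc
    rw [← QuotientGroup.eq_one_iff]
    have h1 := Subgroup.mem_centralizer_iff.1 hb.1.2 _ (Subgroup.mem_map_of_mem _ hc)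
    exact commutatorElement_eq_one_iff_mul_comm.2 h1.symm

end CyclicTorsion

/-! ### Power formulas for a central commutator. -/

section ClassTwo

variable {G : Type*} [Group G]

theorem pow_mul_eq_of_mul_eq {x y w : G} (h : y * x = w * (x * y)) (hwy : Commute w y) (n : ℕ) :
    y ^ n * x = w ^ n * (x * y ^ n) := by
  induction n with
  | zero => simp
  | succ n ih =>
    calc y ^ (n + 1) * x = y * (y ^ n * x) := by rw [pow_succ', mul_assoc]
      _ = (y * w ^ n) * (x * y ^ n) := by rw [ih, mul_assoc]
      _ = w ^ n * (y * x) * y ^ n := by rw [← (hwy.pow_left n).eq]; simp only [mul_assoc]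
      _ = w ^ (n + 1) * (x * y ^ (n + 1)) := by
        rw [h, pow_succ, pow_succ']; simp only [mul_assoc]

theorem mul_pow_of_mul_eq {x y w : G} (h : y * x = w * (x * y)) (hwx : Commute w x)
    (hwy : Commute w y) (n : ℕ) : (x * y) ^ n = w ^ n.choose 2 * (x ^ n * y ^ n) := by
  induction n with
  | zero => simp
  | succ n ih =>
    calc (x * y) ^ (n + 1) = w ^ n.choose 2 * (x ^ n * (y ^ n * x) * y) := by
          rw [pow_succ, ih]; simp only [mul_assoc]
      _ = w ^ n.choose 2 * ((x ^ n * w ^ n) * (x * y ^ n * y)) := by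
          rw [pow_mul_eq_of_mul_eq h hwy]; simp only [mul_assoc]
      _ = w ^ n.choose 2 * w ^ n * (x ^ n * x * (y ^ n * y)) := by
          rw [← (hwx.pow_pow n n).eq]; simp only [mul_assoc]
      _ = w ^ (n + 1).choose 2 * (x ^ (n + 1) * y ^ (n + 1)) := by
          rw [← pow_add, ← pow_succ, ← pow_succ, Nat.choose_succ_succ' n 1, Nat.choose_one_right,
            add_comm (n.choose 2)]

end ClassTwo

/-! ### Automorphisms of groups of order at most four. -/

section MulAutCardFour

theorem derivedSeries_two_perm_fin_three : derivedSeries (Equiv.Perm (Fin 3)) 2 = ⊥ := by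
  have h1 : derivedSeries (Equiv.Perm (Fin 3)) 1 ≤ (Equiv.Perm.sign (α := Fin 3)).ker := by
    rw [derivedSeries_one]
    exact Abelianization.commutator_subset_ker _
  have h2 : ∀ a b : Equiv.Perm (Fin 3), a.sign = 1 → b.sign = 1 → a * b = b * a := by decide
  rw [derivedSeries_succ, Subgroup.commutator_eq_bot_iff_le_centralizer]
  intro a ha
  rw [Subgroup.mem_centralizer_iff]
  exact fun b hb => h2 b a (h1 hb) (h1 ha)

/-- The automorphism group of a group of order at most four is metabelian. -/
theorem derivedSeries_two_mulAut {K : Type*} [Group K] [Finite K] (hK : Nat.card K ≤ 4) :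
    derivedSeries (MulAut K) 2 = ⊥ := by
  -- Automorphisms permute the at most three nonidentity elements faithfully, so Aut(K) embeds in
  -- S₃.
  have hcard : Nat.card {k : K // k ≠ 1} ≤ 3 := by
    classical
    have h1 := Nat.card_congr (Equiv.sumCompl fun k : K => k = 1)
    rw [Nat.card_sum, Nat.card_unique] at h1
    change Nat.card {k : K // ¬ k = 1} ≤ 3
    omega
  obtain ⟨e⟩ : Nonempty ({k : K // k ≠ 1} ↪ Fin 3) := by
    have := Fintype.ofFinite {k : K // k ≠ 1}
    apply Function.Embedding.nonempty_of_card_le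
    rwa [← Nat.card_eq_fintype_card, Fintype.card_fin]
  let φ : MulAut K →* Equiv.Perm {k : K // k ≠ 1} :=
    { toFun := fun f => f.toEquiv.subtypeEquiv fun k => by simp
      map_one' := rfl
      map_mul' := fun _ _ => rfl }
  have hφ : Function.Injective φ := by
    intro f g h
    ext k
    by_cases hk : k = 1
    · rw [hk, map_one, map_one]
    · exact congrArg Subtype.val (DFunLike.congr_fun h ⟨k, hk⟩)
  have hinj : Function.Injective ((Equiv.Perm.viaEmbeddingHom e).comp φ) :=
    (Equiv.Perm.viaEmbeddingHom_injective e).comp hφ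
  rw [← Subgroup.map_eq_bot_iff_of_injective _ hinj, eq_bot_iff]
  exact (map_derivedSeries_le_derivedSeries _ 2).trans derivedSeries_two_perm_fin_three.le

theorem commutatorElement_mem_of_mem_derivedSeries_two {G : Type*} [Group G] [Finite G]
    {A R : Subgroup G} [A.Normal] [R.Normal]
    (hcard : Nat.card (R.map (QuotientGroup.mk' A)) ≤ 4) {g x : G} (hg : g ∈ derivedSeries G 2)
    (hx : x ∈ R) : ⁅g, x⁆ ∈ A := by
  have : (R.map (QuotientGroup.mk' A)).Normal :=
    Subgroup.Normal.map ‹_› _ (QuotientGroup.mk'_surjective _)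
  let φ : G →* MulAut (R.map (QuotientGroup.mk' A)) :=
    MulAut.conjNormal.comp (QuotientGroup.mk' A)
  have h1 : φ g ∈ derivedSeries (MulAut (R.map (QuotientGroup.mk' A))) 2 :=
    map_derivedSeries_le_derivedSeries φ 2 (Subgroup.mem_map_of_mem φ hg)
  rw [derivedSeries_two_mulAut hcard, Subgroup.mem_bot] at h1
  have h2 := congrArg (fun f : MulAut (R.map (QuotientGroup.mk' A)) =>
    (f ⟨_, Subgroup.mem_map_of_mem _ hx⟩ : G ⧸ A)) h1
  simp only [φ, MonoidHom.comp_apply, MulAut.conjNormal_apply, MulAut.one_apply] at h2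
  rw [← QuotientGroup.eq_one_iff]
  exact mul_inv_eq_one.2 h2

end MulAutCardFour

/-! ### Central extensions with elementary abelian quotient; odd primes. -/

section ClassTwoSubgroup

variable {G : Type*} [Group G] {r : ℕ} {R A B : Subgroup G}

/-- In a subgroup with elementary abelian quotient by a central subgroup, commutators have
order dividing `r`. -/
theorem commutatorElement_pow_eq_one (hBA : B ≤ Subgroup.centralizer (A : Set G))
    (hpow : ∀ b ∈ B, b ^ r ∈ A) (hcomm : ∀ b ∈ B, ∀ c ∈ B, ⁅b, c⁆ ∈ A) {x y : G}
    (hx : x ∈ B) (hy : y ∈ B) : ⁅y, x⁆ ^ r = 1 := by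
  have h1 := pow_mul_eq_of_mul_eq (x := x) (y := y) (w := ⁅y, x⁆)
    (by rw [commutatorElement_def]; group)
    (Subgroup.mem_centralizer_iff.1 (hBA hy) _ (hcomm y hy x hx)) r
  rw [Subgroup.mem_centralizer_iff.1 (hBA hx) _ (hpow y hy)] at h1
  exact mul_eq_right.1 h1.symm

theorem mul_pow_of_commutatorElement (hBA : B ≤ Subgroup.centralizer (A : Set G))
    (hcomm : ∀ b ∈ B, ∀ c ∈ B, ⁅b, c⁆ ∈ A) {x y : G}
    (hx : x ∈ B) (hy : y ∈ B) (n : ℕ) : (x * y) ^ n = ⁅y, x⁆ ^ n.choose 2 * (x ^ n * y ^ n) :=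
  mul_pow_of_mul_eq (by rw [commutatorElement_def]; group)
    (Subgroup.mem_centralizer_iff.1 (hBA hx) _ (hcomm y hy x hx))
    (Subgroup.mem_centralizer_iff.1 (hBA hy) _ (hcomm y hy x hx)) n

theorem Subgroup.HasCyclicTorsion.le_centralizer_of_ne_two [hr : Fact r.Prime]
    (hU : R.HasCyclicTorsion r)
    (hR : IsPGroup r R) (hr2 : r ≠ 2) (hAR : A ≤ R) (hBR : B ≤ R)
    (hBA : B ≤ Subgroup.centralizer (A : Set G)) (hpow : ∀ b ∈ B, b ^ r ∈ A)
    (hcomm : ∀ b ∈ B, ∀ c ∈ B, ⁅b, c⁆ ∈ A) : B ≤ Subgroup.centralizer (B : Set G) := by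
  -- If y^r = x^(rk), put u = y·x^(-k). Since `r` is odd, it divides r(r-1)/2, so u^r = 1. If [y, x]
  -- ≠ 1, cyclic torsion puts `u` in ⟨[y, x]⟩ ≤ A, so `u` and hence `y` commutes with `x`.
  have aux : ∀ x ∈ B, ∀ y ∈ B, y ^ r ∈ Subgroup.zpowers (x ^ r) → ⁅y, x⁆ = 1 := by
    intro x hx y hy h
    obtain ⟨k, hk⟩ := h
    replace hk : (x ^ r) ^ k = y ^ r := hk
    by_contra hw
    have hxk : x ^ (-k) ∈ B := zpow_mem hx _
    have hu : (y * x ^ (-k)) ^ r = 1 := by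
      obtain ⟨c, hc⟩ := hr.out.dvd_choose_self (k := 2) two_ne_zero
        (lt_of_le_of_ne hr.out.two_le hr2.symm)
      rw [mul_pow_of_commutatorElement hBA hcomm hy hxk, hc, pow_mul,
        commutatorElement_pow_eq_one hBA hpow hcomm hy hxk, one_pow, one_mul, ← hk,
        ← zpow_natCast (x ^ (-k)), ← zpow_mul, ← zpow_natCast x, ← zpow_mul, ← zpow_add]
      rw [show (r : ℤ) * k + -k * r = 0 by ring, zpow_zero]
    have huB : y * x ^ (-k) ∈ B := mul_mem hy hxk
    have huw := hU _ (hAR (hcomm y hy x hx)) _ (hBR huB)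
      (Subgroup.mem_centralizer_iff.1 (hBA huB) _ (hcomm y hy x hx))
      (commutatorElement_pow_eq_one hBA hpow hcomm hx hy) hu hw
    have huA : y * x ^ (-k) ∈ A := Subgroup.zpowers_le.2 (hcomm y hy x hx) huw
    have h1 : Commute (y * x ^ (-k)) x := Subgroup.mem_centralizer_iff.1 (hBA hx) _ huA
    have h2 : Commute (y * x ^ (-k) * x ^ k) x := h1.mul_left ((Commute.refl x).zpow_left k)
    rw [zpow_neg, inv_mul_cancel_right] at h2
    exact hw h2.commutator_eq
  intro y hy
  rw [Subgroup.mem_centralizer_iff]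
  intro x hx
  rcases hU.mem_zpowers_or hR (hAR (hpow x hx)) (hAR (hpow y hy))
    (Commute.pow_right (Subgroup.mem_centralizer_iff.1 (hBA hy) _ (hpow x hx)) r) with h | h
  · exact (commutatorElement_eq_one_iff_mul_comm.1 (aux x hx y hy h)).symm
  · exact commutatorElement_eq_one_iff_mul_comm.1 (aux y hy x hx h)

end ClassTwoSubgroup

/-! ### The prime two and the quaternion case. -/

section Two

variable {G : Type*} [Group G] {R A B : Subgroup G}

theorem eq_one_or_eq_of_mem_zpowers {w a : G} (hw : w ^ 2 = 1) (ha : a ∈ Subgroup.zpowers w) :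
    a = 1 ∨ a = w := by
  obtain ⟨k, rfl⟩ := ha
  have hw' : w ^ (2 : ℤ) = 1 := by exact_mod_cast hw
  rcases Int.even_or_odd' k with ⟨m, rfl | rfl⟩
  · left
    change w ^ (2 * m) = 1
    rw [zpow_mul, hw', one_zpow]
  · right
    change w ^ (2 * m + 1) = w
    rw [zpow_add, zpow_mul, hw', one_zpow, one_mul, zpow_one]

/-- The cyclic group generated by a `2`-element of order at least four contains an element of
order four. -/
theorem IsPGroup.exists_mem_zpowers_sq_ne_one (hR : IsPGroup 2 R) {c : G} (hc : c ∈ R)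
    (hc2 : c ^ 2 ≠ 1) : ∃ d ∈ Subgroup.zpowers c, d ^ 2 ≠ 1 ∧ (d ^ 2) ^ 2 = 1 := by
  obtain ⟨m, hm⟩ := hR.exists_orderOf_eq hc
  have hm2 : 2 ≤ m := by
    by_contra h
    apply hc2
    rw [← orderOf_dvd_iff_pow_eq_one, hm]
    exact pow_dvd_pow 2 (by omega : m ≤ 1)
  refine ⟨c ^ 2 ^ (m - 2), pow_mem (Subgroup.mem_zpowers c) _, ?_, ?_⟩
  · rw [← pow_mul, ← pow_succ]
    refine pow_ne_one_of_lt_orderOf (by positivity) ?_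
    rw [hm]
    exact Nat.pow_lt_pow_right one_lt_two (by omega)
  · rw [← pow_mul, ← pow_mul, ← sq, ← pow_add, Nat.sub_add_cancel hm2, ← hm, pow_orderOf_eq_one]

/-- If `B` is noncommutative with elementary abelian quotient by a central subgroup `A`, and has
only one involution, then `A` has exponent two. -/
theorem Subgroup.HasCyclicTorsion.sq_eq_one (hU : R.HasCyclicTorsion 2)
    (hR : IsPGroup 2 R) (hAR : A ≤ R) (hBR : B ≤ R) (hAB : A ≤ B)
    (hBA : B ≤ Subgroup.centralizer (A : Set G)) (hpow : ∀ b ∈ B, b ^ 2 ∈ A)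
    (hcomm : ∀ b ∈ B, ∀ c ∈ B, ⁅b, c⁆ ∈ A) (hBB : ¬ B ≤ Subgroup.centralizer (B : Set G)) :
    ∀ a ∈ A, a ^ 2 = 1 := by
  have := Fact.mk Nat.prime_two
  by_contra! hA
  obtain ⟨a₀, ha₀, ha₀2⟩ := hA
  obtain ⟨a, haz, ha2, ha4⟩ := hR.exists_mem_zpowers_sq_ne_one (hAR ha₀) ha₀2
  have ha : a ∈ A := Subgroup.zpowers_le.2 ha₀ haz
  -- With `a` of order four in `A`, every u ∈ B whose square is 1 or a² lies in `A`. In `aux`, the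
  -- square of y·x^(-k) is a commutator, hence 1 or a².
  have hu1 : ∀ u ∈ B, u ^ 2 = 1 → u ∈ A := fun u hu hu2 =>
    Subgroup.zpowers_le.2 (pow_mem ha 2) (hU _ (hAR (pow_mem ha 2)) u (hBR hu)
      (Subgroup.mem_centralizer_iff.1 (hBA hu) _ (pow_mem ha 2)) ha4 hu2 ha2)
  have hu2 : ∀ u ∈ B, u ^ 2 = a ^ 2 → u ∈ A := fun u hu h => by
    have h1 : (u * a⁻¹) ^ 2 = 1 := by
      have hau : Commute a u := Subgroup.mem_centralizer_iff.1 (hBA hu) _ ha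
      rw [hau.symm.inv_right.mul_pow, h, inv_pow, mul_inv_cancel]
    have := mul_mem (hu1 _ (mul_mem hu (inv_mem (hAB ha))) h1) ha
    rwa [inv_mul_cancel_right] at this
  have aux : ∀ x ∈ B, ∀ y ∈ B, y ^ 2 ∈ Subgroup.zpowers (x ^ 2) → Commute y x := by
    intro x hx y hy h
    obtain ⟨k, hk⟩ := h
    replace hk : (x ^ 2) ^ k = y ^ 2 := hk
    have hxk : x ^ (-k) ∈ B := zpow_mem hx _
    have hw2 := commutatorElement_pow_eq_one hBA hpow hcomm hy hxk
    have hu : (y * x ^ (-k)) ^ 2 = ⁅x ^ (-k), y⁆ := by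
      rw [mul_pow_of_commutatorElement hBA hcomm hy hxk, Nat.choose_self, pow_one, ← hk,
        ← zpow_natCast (x ^ (-k)), ← zpow_mul, ← zpow_natCast x, ← zpow_mul, ← zpow_add,
        show ((2 : ℕ) : ℤ) * k + -k * (2 : ℕ) = 0 by ring, zpow_zero, mul_one]
    have huB : y * x ^ (-k) ∈ B := mul_mem hy hxk
    have hwA := hcomm _ hxk y hy
    have huA : y * x ^ (-k) ∈ A := by
      rcases eq_one_or_eq_of_mem_zpowers ha4 (hU _ (hAR (pow_mem ha 2)) _ (hAR hwA)
        (Subgroup.mem_centralizer_iff.1 (hBA (hAB hwA)) _ (pow_mem ha 2)) ha4 hw2 ha2) with h | h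
      · exact hu1 _ huB (hu.trans h)
      · exact hu2 _ huB (hu.trans h)
    have h1 : Commute (y * x ^ (-k)) x := Subgroup.mem_centralizer_iff.1 (hBA hx) _ huA
    have h2 : Commute (y * x ^ (-k) * x ^ k) x := h1.mul_left ((Commute.refl x).zpow_left k)
    rwa [zpow_neg, inv_mul_cancel_right] at h2
  refine hBB fun y hy => ?_
  rw [Subgroup.mem_centralizer_iff]
  intro x hx
  rcases hU.mem_zpowers_or hR (hAR (hpow x hx)) (hAR (hpow y hy))
    (Commute.pow_right (Subgroup.mem_centralizer_iff.1 (hBA hy) _ (hpow x hx)) 2) with h | h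
  · exact (aux x hx y hy h).symm
  · exact aux y hy x hx h

/-- An element commuting with `x` and `y` up to a central involution `w = ⁅x, y⁆` commutes with
them after multiplication by one of `1, x, y, x * y`. -/
theorem exists_mul_commute {x y w g : G} (hw2 : w * w = 1) (hw : ∀ h, Commute w h)
    (hxy : x * y = w * (y * x)) (hgx : ⁅g, x⁆ = 1 ∨ ⁅g, x⁆ = w)
    (hgy : ⁅g, y⁆ = 1 ∨ ⁅g, y⁆ = w) :
    ∃ t, (t = 1 ∨ t = x ∨ t = y ∨ t = x * y) ∧ Commute (t * g) x ∧ Commute (t * g) y := by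
  -- Rewriting rules that collect the central `w` on the left and sort the remaining letters.
  have hyx : y * x = w * (x * y) := by rw [hxy, ← mul_assoc, hw2, one_mul]
  have hcan : ∀ h : G, w * (w * h) = h := fun h => by rw [← mul_assoc, hw2, one_mul]
  have conv : ∀ {z v : G}, ⁅g, z⁆ = v → g * z = v * (z * g) := fun {z v} h => by
    rw [← h, commutatorElement_def]; group
  have hpull : ∀ a b : G, a * (w * b) = w * (a * b) := fun a b => by
    rw [← mul_assoc, ← (hw a).eq, mul_assoc]
  have hxy' : ∀ b, y * (x * b) = w * (x * (y * b)) := fun b => by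
    rw [← mul_assoc, hyx]; simp only [mul_assoc]
  rcases hgx with h1 | h1 <;> rcases hgy with h2 | h2 <;> replace h1 := conv h1 <;>
    replace h2 := conv h2
  · exact ⟨1, by simp, by simpa [commute_iff_eq] using h1, by simpa [commute_iff_eq] using h2⟩
  · refine ⟨x, by simp, ?_, ?_⟩ <;>
      simp only [commute_iff_eq, mul_assoc, h1, h2, hpull, hxy', one_mul]
  · refine ⟨y, by simp, ?_, ?_⟩ <;>
      simp only [commute_iff_eq, mul_assoc, h1, h2, hpull, hxy', hcan, one_mul]
  · refine ⟨x * y, by simp, ?_, ?_⟩ <;>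
      simp only [commute_iff_eq, mul_assoc, h1, h2, hpull, hxy', hcan]

/-- The quaternion case: the second derived subgroup acts on `R` by inner automorphisms. -/
theorem Subgroup.HasCyclicTorsion.exists_mul_mem_centralizer [Finite G] [R.Normal] [A.Normal]
    (hU : R.HasCyclicTorsion 2) (hR : IsPGroup 2 R) (hBR : B ≤ R) (hAB : A ≤ B)
    (hA2 : ∀ a ∈ A, a ^ 2 = 1) (hcomm : ∀ b ∈ B, ∀ c ∈ R ⊓ Subgroup.centralizer (A : Set G),
      ⁅b, c⁆ ∈ A) (hBA : B ≤ Subgroup.centralizer (A : Set G))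
    (hpow : ∀ b ∈ B, b ^ 2 ∈ A)
    (hBB : ¬ B ≤ Subgroup.centralizer (B : Set G)) {g : G} (hg : g ∈ derivedSeries G 2) :
    ∃ t ∈ R, t * g ∈ Subgroup.centralizer (R : Set G) := by
  have hBC : B ≤ R ⊓ Subgroup.centralizer (A : Set G) := le_inf hBR hBA
  obtain ⟨x, y, hx, hy, hxy⟩ : ∃ x y, x ∈ B ∧ y ∈ B ∧ ¬ x * y = y * x := by
    by_contra! h
    exact hBB fun y hy => Subgroup.mem_centralizer_iff.2 fun x hx => h x y hx hy
  set w := ⁅x, y⁆ with hwdef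
  have hwA : w ∈ A := hcomm x hx y (hBC hy)
  have hw1 : w ≠ 1 := fun h => hxy (commutatorElement_eq_one_iff_mul_comm.1 h)
  have hw2 : w ^ 2 = 1 := hA2 w hwA
  have hAw : ∀ a ∈ A, a = 1 ∨ a = w := fun a ha => eq_one_or_eq_of_mem_zpowers hw2
    (hU w (hBR (hAB hwA)) a (hBR (hAB ha))
      (Subgroup.mem_centralizer_iff.1 (hBA (hAB ha)) w hwA) hw2 (hA2 a ha) hw1)
  have hwc : ∀ h, Commute w h := by
    intro h
    rcases hAw _ (Subgroup.Normal.conj_mem ‹_› w hwA h) with h1 | h1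
    · exact absurd (by simpa using h1) hw1
    · exact (mul_inv_eq_iff_eq_mul.1 h1).symm
  have hAc : ∀ a ∈ A, ∀ h, Commute a h := by
    intro a ha h
    rcases hAw a ha with rfl | rfl
    · exact Commute.one_left h
    · exact hwc h
  have hRA : R ≤ R ⊓ Subgroup.centralizer (A : Set G) :=
    le_inf le_rfl fun c _ => Subgroup.mem_centralizer_iff.2 fun a ha => hAc a ha c
  have hinv : ∀ u ∈ R, u ^ 2 = 1 → u ∈ A := fun u hu hu2 =>
    Subgroup.zpowers_le.2 hwA (hU w (hBR (hAB hwA)) u hu (hwc u) hw2 hu2 hw1)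
  have hxA : x ∉ A := fun h => hxy (hAc x h y)
  have hx2 : x ^ 2 = w :=
    (hAw _ (hpow x hx)).resolve_left fun h => hxA (hinv x (hBR hx) h)
  -- Otherwise ⟨c⟩ contains `d` with d² = w = x². Then (dx)² = 1, so dx is in the central subgroup
  -- `A`, and `x` would commute with `y` because `d` does.
  have hcent : ∀ c ∈ R, Commute c x → Commute c y → c ∈ A := by
    intro c hc hcx hcy
    by_contra hcA
    obtain ⟨d, hdz, hd2, hd4⟩ := hR.exists_mem_zpowers_sq_ne_one hc fun h => hcA (hinv c hc h)
    have hdR : d ∈ R := Subgroup.zpowers_le.2 hc hdz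
    obtain ⟨k, rfl⟩ := hdz
    have hdx : Commute (c ^ k) x := hcx.zpow_left k
    have hdw := (hAw _ (hinv _ (pow_mem hdR 2) hd4)).resolve_left hd2
    have h1 : c ^ k * x ∈ A := hinv _ (mul_mem hdR (hBR hx)) (by
      rw [hdx.mul_pow, hdw, hx2, ← sq, hw2])
    have h2 : Commute ((c ^ k)⁻¹ * (c ^ k * x)) y :=
      (hcy.zpow_left k).inv_left.mul_left (hAc _ h1 y)
    rw [inv_mul_cancel_left] at h2
    exact hxy h2
  have hword : ∀ h : G, ⁅h, x⁆ ∈ A → ⁅h, y⁆ ∈ A →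
      ∃ t, (t = 1 ∨ t = x ∨ t = y ∨ t = x * y) ∧ Commute (t * h) x ∧ Commute (t * h) y :=
    fun h h1 h2 => exists_mul_commute (by rw [← sq, hw2]) hwc
      (by rw [hwdef, commutatorElement_def]; group) (hAw _ h1) (hAw _ h2)
  have hmem : ∀ {t : G}, (t = 1 ∨ t = x ∨ t = y ∨ t = x * y) → t ∈ R := by
    rintro t (rfl | rfl | rfl | rfl)
    exacts [one_mem _, hBR hx, hBR hy, mul_mem (hBR hx) (hBR hy)]
  have hRw : ∀ c ∈ R, ∃ t, (t = 1 ∨ t = x ∨ t = y ∨ t = x * y) ∧ t * c ∈ A := by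
    intro c hc
    have hswap : ∀ b ∈ B, ⁅c, b⁆ ∈ A := fun b hb => by
      rw [← commutatorElement_inv]; exact inv_mem (hcomm b hb c (hRA hc))
    obtain ⟨t, ht, h1, h2⟩ := hword c (hswap x hx) (hswap y hy)
    exact ⟨t, ht, hcent _ (mul_mem (hmem ht) hc) h1 h2⟩
  have hcard : Nat.card (R.map (QuotientGroup.mk' A)) ≤ 4 := by
    have hsub : ((R.map (QuotientGroup.mk' A) : Subgroup (G ⧸ A)) : Set (G ⧸ A)) ⊆
        {1, (x : G ⧸ A)⁻¹, (y : G ⧸ A)⁻¹, ((x * y : G) : G ⧸ A)⁻¹} := by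
      rintro _ ⟨c, hc, rfl⟩
      obtain ⟨t, ht, htc⟩ := hRw c hc
      have h1 : (t : G ⧸ A) * (c : G ⧸ A) = 1 := (QuotientGroup.eq_one_iff _).2 htc
      have h2 : (c : G ⧸ A) = (t : G ⧸ A)⁻¹ := eq_inv_of_mul_eq_one_right h1
      rw [QuotientGroup.mk'_apply, h2]
      rcases ht with rfl | rfl | rfl | rfl <;> simp
    refine (Set.ncard_le_ncard hsub (Set.toFinite _)).trans ?_
    refine (Set.ncard_insert_le _ _).trans (Nat.succ_le_succ ?_)
    refine (Set.ncard_insert_le _ _).trans (Nat.succ_le_succ ?_)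
    refine (Set.ncard_insert_le _ _).trans (Nat.succ_le_succ ?_)
    exact (Set.ncard_singleton _).le
  -- As |R/A| ≤ 4, `g` acts trivially on R/A, so [g, x] and [g, y] lie in A = {1, w}. Correcting by
  -- `t` makes tg commute with `x`, `y` and `A`, which generate `R`.
  obtain ⟨t, ht, h1, h2⟩ := hword g
    (commutatorElement_mem_of_mem_derivedSeries_two hcard hg (hBR hx))
    (commutatorElement_mem_of_mem_derivedSeries_two hcard hg (hBR hy))
  refine ⟨t, hmem ht, Subgroup.mem_centralizer_iff.2 fun c hc => ?_⟩
  obtain ⟨s, hs, hsc⟩ := hRw c hc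
  have h3 : Commute s (t * g) := by
    rcases hs with rfl | rfl | rfl | rfl
    exacts [Commute.one_left _, h1.symm, h2.symm, h1.symm.mul_left h2.symm]
  have h4 : Commute (s⁻¹ * (s * c)) (t * g) := h3.inv_left.mul_left (hAc _ hsc _)
  rw [inv_mul_cancel_left] at h4
  exact h4

end Two

/-! ### Action of the second derived subgroup on one r-subgroup. -/

section Local

variable {G : Type*} [Group G] [Finite G] {r : ℕ} [hr : Fact r.Prime] {R : Subgroup G}

/-- Take A maximal among the abelian normal subgroups of G inside `R`; it is cyclic. If C_R(A) = A,
the three subgroups argument applies with t = 1. Otherwise some B > A in C_R(A) has B/A central of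
exponent `r`, and is nonabelian by maximality. This is impossible for odd `r` and is the quaternion
case for r = 2. -/
theorem Subgroup.HasCyclicTorsion.exists_derivedSeries_two_mul_mem_centralizer [R.Normal]
    (hU : R.HasCyclicTorsion r) (hR : IsPGroup r R) {g : G} (hg : g ∈ derivedSeries G 2) :
    ∃ t ∈ R, (r ≠ 2 → t = 1) ∧ t * g ∈ Subgroup.centralizer (R : Set G) := by
  obtain ⟨A, ⟨hAn, hAR, hA⟩, hmax⟩ := Set.Finite.exists_maximal
    (Set.toFinite {A : Subgroup G | A.Normal ∧ A ≤ R ∧ A ≤ Subgroup.centralizer (A : Set G)})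
    ⟨⊥, inferInstance, bot_le, bot_le⟩
  have hAC : A ≤ R ⊓ Subgroup.centralizer (A : Set G) := le_inf hAR hA
  by_cases hCA : R ⊓ Subgroup.centralizer (A : Set G) ≤ A
  · refine ⟨1, one_mem _, fun _ => rfl, ?_⟩
    rw [one_mul]
    exact derivedSeries_two_le_centralizer
      (commutator_le_centralizer_of_isCyclic (hU.isCyclic hR hAR hA)) hCA hg
  · obtain ⟨B, hBn, hAB, hBC, hBA, hpow, hcomm⟩ :=
      (hR.to_le inf_le_left).exists_normal_central_exponent hAC hCA
    have hBR : B ≤ R := hBC.trans inf_le_left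
    have hBcA := hBC.trans inf_le_right
    have hBB : ¬ B ≤ Subgroup.centralizer (B : Set G) := fun h =>
      hBA (hmax (y := B) ⟨hBn, hBR, h⟩ hAB)
    have hcommB : ∀ b ∈ B, ∀ c ∈ B, ⁅b, c⁆ ∈ A := fun b hb c hc => hcomm b hb c (hBC hc)
    obtain rfl | hr2 := eq_or_ne r 2
    · obtain ⟨t, ht, htg⟩ := hU.exists_mul_mem_centralizer hR hBR hAB
        (hU.sq_eq_one hR hAR hBR hAB hBcA hpow hcommB hBB) hcomm hBcA hpow hBB hg
      exact ⟨t, ht, fun h => absurd rfl h, htg⟩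
    · exact absurd (hU.le_centralizer_of_ne_two hR hr2 hAR hBR hBcA hpow hcommB) hBB

end Local

/-! ### Gluing the primes. -/

section Global

variable {G : Type*} [Group G]

theorem Subgroup.eq_top_of_forall_sylow_le [Finite G] {D : Subgroup G}
    (h : ∀ (r : ℕ) [Fact r.Prime] (S : Sylow r G), S ≤ D) : D = ⊤ := by
  rw [← Subgroup.index_eq_one]
  by_contra hD
  obtain ⟨r, hr, hrD⟩ := Nat.exists_prime_and_dvd hD
  have := Fact.mk hr
  obtain ⟨S⟩ : Nonempty (Sylow r G) := inferInstance
  exact S.not_dvd_index (hrD.trans (Subgroup.index_dvd_of_le (h r S)))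

theorem Sylow.normal_map_subtype [Finite G] {F : Subgroup G} [F.Normal]
    (hF : Group.IsNilpotent F) {r : ℕ} [Fact r.Prime] (S : Sylow r F) :
    ((S : Subgroup F).map F.subtype).Normal := by
  have := S.characteristic_of_normal inferInstance
  infer_instance

theorem derivedSeries_two_le_of_hasCyclicTorsion [Finite G] {F : Subgroup G} [F.Normal]
    (hF : Group.IsNilpotent F) (hC : Subgroup.centralizer (F : Set G) ≤ F)
    (hU : ∀ (r : ℕ) [Fact r.Prime] (S : Sylow r F),
      ((S : Subgroup F).map F.subtype).HasCyclicTorsion r) :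
    derivedSeries G 2 ≤ F := by
  intro g hg
  obtain ⟨T⟩ : Nonempty (Sylow 2 F) := inferInstance
  have hTn := T.normal_map_subtype hF
  obtain ⟨t, ht, -, htg⟩ := (hU 2 T).exists_derivedSeries_two_mul_mem_centralizer
    (T.isPGroup'.map _) hg
  have htF : t ∈ F := Subgroup.map_subtype_le _ ht
  rw [← Subgroup.mul_mem_cancel_left F htF]
  refine hC ?_
  -- It suffices to check Sylow subgroups of `F`. At 2 this is the choice of `t`; at odd primes `g`
  -- centralizes the Sylow subgroup, and so does the 2-element `t`, since `F` is nilpotent.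
  have key : (Subgroup.centralizer {t * g}).subgroupOf F = ⊤ := by
    refine Subgroup.eq_top_of_forall_sylow_le fun r _ S s hs => ?_
    have hSn := S.normal_map_subtype hF
    have hs' : (s : G) ∈ (S : Subgroup F).map F.subtype := Subgroup.mem_map_of_mem F.subtype hs
    rw [Subgroup.mem_subgroupOf, Subgroup.mem_centralizer_singleton_iff]
    obtain rfl | hr2 := eq_or_ne r 2
    · have : Subsingleton (Sylow 2 F) := (Sylow.unique_of_normal T inferInstance).instSubsingleton
      rw [Subsingleton.elim S T] at hs'
      exact Subgroup.mem_centralizer_iff.1 htg _ hs'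
    · obtain ⟨u, -, hu, hug⟩ := (hU r S).exists_derivedSeries_two_mul_mem_centralizer
        (S.isPGroup'.map _) hg
      rw [hu hr2, one_mul] at hug
      have h1 : Commute (s : G) g := Subgroup.mem_centralizer_iff.1 hug _ hs'
      have h2 : Commute (s : G) t := Subgroup.commute_of_normal_of_disjoint _ _ hSn hTn
        (IsPGroup.disjoint_of_ne r 2 hr2 _ _ (S.isPGroup'.map _) (T.isPGroup'.map _)) _ _ hs' ht
      exact h2.mul_right h1
  rw [Subgroup.mem_centralizer_iff]
  intro f hf
  have h1 : (⟨f, hf⟩ : F) ∈ (Subgroup.centralizer {t * g}).subgroupOf F := key ▸ Subgroup.mem_top _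
  rwa [Subgroup.mem_subgroupOf, Subgroup.mem_centralizer_singleton_iff] at h1

/-- A nontrivial normal subgroup of a nilpotent group meets the center nontrivially. -/
theorem Subgroup.exists_mem_center_of_isNilpotent [hG : Group.IsNilpotent G] {H : Subgroup G}
    [H.Normal] (hH : H ≠ ⊥) : ∃ h ∈ H, h ∈ Subgroup.center G ∧ h ≠ 1 := by
  have key : ∀ n, (∃ h ∈ H, h ∈ Subgroup.upperCentralSeries G n ∧ h ≠ 1) →
      ∃ h ∈ H, h ∈ Subgroup.center G ∧ h ≠ 1 := by
    intro n
    induction n with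
    | zero =>
      rintro ⟨h, -, h2, h3⟩
      rw [Subgroup.upperCentralSeries_zero] at h2
      exact absurd h2 h3
    | succ n ih =>
      rintro ⟨h, h1, h2, h3⟩
      by_cases hc : h ∈ Subgroup.center G
      · exact ⟨h, h1, hc, h3⟩
      · rw [Subgroup.mem_center_iff] at hc
        push Not at hc
        obtain ⟨g, hg⟩ := hc
        refine ih ⟨h * g * h⁻¹ * g⁻¹, ?_, ?_, fun h4 => hg ?_⟩
        -- A nontrivial commutator with `h` stays in `H` and descends one step of the upper central
        -- series.
        · have := mul_mem h1 (Subgroup.Normal.conj_mem ‹_› _ (inv_mem h1) g)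
          simpa [mul_assoc] using this
        · exact Subgroup.mem_upperCentralSeries_succ_iff.1 h2 g
        · rw [mul_inv_eq_one, mul_inv_eq_iff_eq_mul] at h4
          exact h4.symm
  obtain ⟨n, hn⟩ := hG.nilpotent
  obtain ⟨h, h1⟩ := Subgroup.ne_bot_iff_exists_ne_one.1 hH
  exact key n ⟨h, h.2, hn ▸ Subgroup.mem_top _, fun h2 => h1 (Subtype.ext h2)⟩

theorem Subgroup.exists_pow_eq_one_mem_centralizer [Finite G] {L H : Subgroup G} [H.Normal]
    (hL : Group.IsNilpotent L) (hHL : H ≤ L) {p : ℕ} [hp : Fact p.Prime] (hH : IsPGroup p H)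
    (hH1 : H ≠ ⊥) :
    ∃ v ∈ H, v ∈ Subgroup.centralizer (L : Set G) ∧ v ^ p = 1 ∧ v ≠ 1 := by
  have hne : H.subgroupOf L ≠ ⊥ := by
    rw [Ne, Subgroup.subgroupOf_eq_bot, Subgroup.disjoint_def]
    intro h
    exact hH1 ((Subgroup.eq_bot_iff_forall H).2 fun x hx => h hx (hHL hx))
  obtain ⟨h, h1, h2, h3⟩ := Subgroup.exists_mem_center_of_isNilpotent hne
  have hc : (h : G) ∈ Subgroup.centralizer (L : Set G) := Subgroup.mem_centralizer_iff.2
    fun l hl => congrArg Subtype.val (Subgroup.mem_center_iff.1 h2 ⟨l, hl⟩)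
  obtain ⟨k, hk⟩ := hH.exists_orderOf_eq h1
  change orderOf (h : G) = p ^ k at hk
  have hk0 : k ≠ 0 := by
    rintro rfl
    rw [pow_zero, orderOf_eq_one_iff] at hk
    exact h3 (Subtype.ext hk)
  have hk1 : k - 1 + 1 = k := by omega
  refine ⟨(h : G) ^ p ^ (k - 1), pow_mem h1 _, pow_mem hc _, ?_, ?_⟩
  · rw [← pow_mul, ← pow_succ, hk1, ← hk, pow_orderOf_eq_one]
  · refine pow_ne_one_of_lt_orderOf (pow_pos hp.out.pos _).ne' ?_
    rw [hk]
    exact Nat.pow_lt_pow_right hp.out.one_lt (by omega)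

theorem IsEqualOrderPair.fittingHeight_le_four_of_forall_prime [Finite G] [Group.IsSolvable G]
    {N L : Subgroup G} (hN : IsEqualOrderPair G N) [L.Normal] (hL : Group.IsNilpotent L)
    (hNL : N ≤ L)
    (h : ∀ r : ℕ, r.Prime → (∀ R : Subgroup (G ⧸ L), R.Normal → IsPGroup r R → R = ⊥) ∨
      ∃ p : ℕ, p.Prime ∧ p ≠ r ∧
        ∃ v ∈ N, v ∈ Subgroup.centralizer (L : Set G) ∧ v ^ p = 1 ∧ v ≠ 1) :
    fittingHeight G ≤ 4 := by
  obtain ⟨F, hFn, hF, hC⟩ := exists_normal_isNilpotent_centralizer_le (G := G ⧸ L)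
  refine fittingHeight_le_four hL hF (derivedSeries_two_le_of_hasCyclicTorsion hF hC ?_)
  intro r hr S x hx y hy hxy hxr hyr hx1
  rcases h r hr.out with h | ⟨p, hp, hpr, v, hv, hvL, hvp, hv1⟩
  · rw [h _ (S.normal_map_subtype hF) (S.isPGroup'.map _)] at hx
    exact absurd hx hx1
  · exact hN.mem_zpowers_of_commute hNL hp hr.out hpr hv hvL hvp hv1 hxy hxr hyr hx1

end Global

/-! ### Choice of L. -/

theorem mainTheorem8 (G : Type*) [Group G] [Finite G] [Group.IsSolvable G] (N : Subgroup G)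
    (hN : IsEqualOrderPair G N) (hnil : Group.IsNilpotent N) :
    fittingHeight G ≤ 4 := by
  have hNn := hN.normal
  have hcard : Nat.card N ≠ 1 := fun h => hN.ne_bot (Subgroup.card_eq_one.1 h)
  obtain ⟨p, hp, hpN⟩ := Nat.exists_prime_and_dvd hcard
  have := Fact.mk hp
  by_cases hq : ∃ q : ℕ, q.Prime ∧ q ∣ Nat.card N ∧ q ≠ p
  · obtain ⟨q, hq, hqN, hqp⟩ := hq
    have hv : ∀ s : ℕ, s.Prime → s ∣ Nat.card N →
        ∃ v ∈ N, v ∈ Subgroup.centralizer (N : Set G) ∧ v ^ s = 1 ∧ v ≠ 1 := by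
      intro s hs hsN
      have := Fact.mk hs
      obtain ⟨S⟩ : Nonempty (Sylow s N) := inferInstance
      have hSn := S.normal_map_subtype hnil
      obtain ⟨v, h1, h2⟩ := Subgroup.exists_pow_eq_one_mem_centralizer hnil
        (Subgroup.map_subtype_le (S : Subgroup N)) (S.isPGroup'.map _) (by
          rw [Ne, Subgroup.map_eq_bot_iff_of_injective _ N.subtype_injective]
          exact S.ne_bot_of_dvd_card hsN)
      exact ⟨v, Subgroup.map_subtype_le _ h1, h2⟩
    refine hN.fittingHeight_le_four_of_forall_prime hnil le_rfl fun r hr => Or.inr ?_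
    obtain rfl | hrp := eq_or_ne p r
    · exact ⟨q, hq, hqp, hv q hq hqN⟩
    · exact ⟨p, hp, hrp, hv p hp hpN⟩
  · push Not at hq
    have hNp : IsPGroup p N := IsPGroup.of_card
      (Nat.eq_prime_pow_of_unique_prime_dvd Nat.card_pos.ne' fun {d} hd hdN => hq d hd hdN)
    -- Enlarging N to O_p(G) handles r = p: the preimage of a normal p-subgroup of G/L is again a
    -- normal p-subgroup, so it equals `L`.
    obtain ⟨L, ⟨hLn, hNL, hL⟩, hmax⟩ := Set.Finite.exists_maximal
      (Set.toFinite {L : Subgroup G | L.Normal ∧ N ≤ L ∧ IsPGroup p L}) ⟨N, hNn, le_rfl, hNp⟩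
    have hLnil : Group.IsNilpotent L := hL.isNilpotent
    refine hN.fittingHeight_le_four_of_forall_prime hLnil hNL fun r hr => ?_
    obtain rfl | hrp := eq_or_ne p r
    · refine Or.inl fun R hRn hR => ?_
      have hLR : L ≤ R.comap (QuotientGroup.mk' L) := by
        simpa using (QuotientGroup.mk' L).ker_le_comap R
      have hRp : IsPGroup p (R.comap (QuotientGroup.mk' L)) :=
        hR.comap_of_ker_isPGroup _ (by rwa [QuotientGroup.ker_mk'])
      have h1 := hmax (y := R.comap (QuotientGroup.mk' L))
        ⟨inferInstance, hNL.trans hLR, hRp⟩ hLR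
      rw [← Subgroup.map_comap_eq_self_of_surjective (QuotientGroup.mk'_surjective L) R,
        Subgroup.map_eq_bot_iff, QuotientGroup.ker_mk']
      exact h1
    · exact Or.inr ⟨p, hp, hrp,
        Subgroup.exists_pow_eq_one_mem_centralizer hLnil hNL hNp hN.ne_bot⟩
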